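/- Let $G$ be a group, $N \trianglelefteq G$ a normal subgroup and $\mathcal H$ a set of proper subgroups of $G$ (possibly infinite). For a group $\Gamma$ and a set $\mathcal F$ of subgroups of $\Gamma$, the coset complex $CC(\Gamma,\mathcal F)$ is the simplicial complex whose vertices are the left cosets $\gamma F$ with $\gamma\in\Gamma$, $F\in\mathcal F$, and in which finitely many such cosets form a simplex if and only if their intersection is non-empty. Put $$\mathcal H_N=\{H\in\mathcal H : HN\neq G\},\qquad \mathcal H^N=\{K\in\mathcal H : KN=G\},$$ $$\overline{\mathcal H}=\{HN/N : H\in\mathcal H_N\},\qquad \mathcal H\cap N=\{K\cap N : K\in\mathcal H^N\},$$ which are sets of subgroups of $G/N$ and of $N$, respectively. Suppose that $\mathcal H$ is strongly divided by $N$, that is, (1) $N\subseteq H$ for every $H\in\mathcal H_N$, and (2) $(K_1\cap\dots\cap K_m)N=G$ for all $K_1,\dots,K_m\in\mathcal H^N$. Then there is a homotopy equivalence $$|CC(G,\mathcal H)|\;\simeq\;|CC(G/N,\overline{\mathcal H})| * |CC(N,\mathcal H\cap N)|,$$ where $|\cdot|$ denotes the geometric realisation (with the weak topology) and $*$ the topological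 join, i.e. $X*Y$ is the quotient of $X\sqcup Y\sqcup (X\times Y\times[0,1])$ by $(x,y,0)\sim x$ and $(x,y,1)\sim y$ (so $X*\emptyset=X$ and $\emptyset*Y=Y$). -/

import Mathlib

open scoped Pointwise ContinuousMap unitInterval

/-! ### Geometric realisations and joins -/

/-- The geometric realisation of an abstract simplicial complex `K` with vertices in `V`: the set of
finitely supported functions `V → [0, ∞)` (barycentric coordinates) with total mass `1` whose
support is a simplex of `K`. -/
def GeometricRealization {V : Type*} (K : PreAbstractSimplicialComplex V) : Type _ :=
  {x : V →₀ ℝ // (∀ v, 0 ≤ x v) ∧ x.support ∈ K.faces ∧ (x.sum fun _ r => r) = 1}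

namespace GeometricRealization

variable {V : Type*} {K : PreAbstractSimplicialComplex V}

/-- The barycentric coordinates of a point of the realisation. -/
def coord (x : GeometricRealization K) (v : V) : ℝ := x.1 v

/-- The closed simplex spanned by a finite set `s` of vertices. -/
def closedSimplex (K : PreAbstractSimplicialComplex V) (s : Finset V) :
    Set (GeometricRealization K) :=
  {x | ∀ v, v ∉ s → x.coord v = 0}

/-- A closed simplex carries its Euclidean topology, i.e. that of convergence of the barycentric
coordinates (all but finitely many of them vanish identically on it). -/
@[reducible] def simplexTopology (K : PreAbstractSimplicialComplex V) (s : Finset V) :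
    TopologicalSpace (closedSimplex K s) :=
  TopologicalSpace.induced (fun x => x.1.coord) Pi.topologicalSpace

/-- The weak topology: the finest topology for which the inclusions of all closed simplices are
continuous, i.e. a set is open iff its intersection with each closed simplex is open there. -/
instance : TopologicalSpace (GeometricRealization K) :=
  ⨆ s : K.faces, TopologicalSpace.coinduced
    (Subtype.val : closedSimplex K s.1 → GeometricRealization K) (simplexTopology K s.1)

end GeometricRealization

/-- The identifications `(x, y, 0) ∼ x` and `(x, y, 1) ∼ y` which define the join. -/
inductive TopologicalJoin.Rel (X Y : Type*) : X ⊕ Y ⊕ X × Y × I → X ⊕ Y ⊕ X × Y × I → Prop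
  | left (x : X) (y : Y) : TopologicalJoin.Rel X Y (.inr (.inr (x, y, 0))) (.inl x)
  | right (x : X) (y : Y) : TopologicalJoin.Rel X Y (.inr (.inr (x, y, 1))) (.inr (.inl y))

/-- The topological join `X * Y`: the quotient space of `X ⊔ Y ⊔ X × Y × [0, 1]` by
`(x, y, 0) ∼ x` and `(x, y, 1) ∼ y`. If `Y` is empty this is `X`, and conversely. -/
def TopologicalJoin (X Y : Type*) : Type _ := Quot (TopologicalJoin.Rel X Y)

instance {X Y : Type*} [TopologicalSpace X] [TopologicalSpace Y] :
    TopologicalSpace (TopologicalJoin X Y) :=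
  inferInstanceAs (TopologicalSpace (Quot (TopologicalJoin.Rel X Y)))

/-! ### Coset complexes -/

/-- The nerve of a collection `U` of subsets of `X`: its vertices are the (nonempty) members of `U`,
and finitely many of them form a simplex iff their intersection is nonempty. -/
def nerveOfCollection {X : Type*} (U : Set (Set X)) : PreAbstractSimplicialComplex (Set X) where
  faces := {s | s.Nonempty ∧ (s : Set (Set X)) ⊆ U ∧ (⋂₀ (s : Set (Set X))).Nonempty}
  isRelLowerSet_faces := fun _ hs =>
    ⟨hs.1, fun _ hts ht => ⟨ht, (Finset.coe_subset.2 hts).trans hs.2.1,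
      hs.2.2.mono (Set.sInter_subset_sInter (Finset.coe_subset.2 hts))⟩⟩

section CosetComplex

variable {G : Type*} [Group G]

/-- All left cosets `gH` with `g : G` and `H` a member of the family `𝓗`. -/
def cosetCollection (𝓗 : Set (Subgroup G)) : Set (Set G) :=
  {C | ∃ H ∈ 𝓗, ∃ g : G, C = g • (H : Set G)}

/-- The coset complex of `G` with respect to the family `𝓗`. -/
def cosetComplex (𝓗 : Set (Subgroup G)) : PreAbstractSimplicialComplex (Set G) :=
  nerveOfCollection (cosetCollection 𝓗)

/-- The subfamily of those `H` in `𝓗` with `HN ≠ G`. -/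
def nonSupplements (𝓗 : Set (Subgroup G)) (N : Subgroup G) : Set (Subgroup G) :=
  {H ∈ 𝓗 | (H : Set G) * (N : Set G) ≠ Set.univ}

/-- The subfamily of those `K` in `𝓗` with `KN = G`. -/
def supplements (𝓗 : Set (Subgroup G)) (N : Subgroup G) : Set (Subgroup G) :=
  {K ∈ 𝓗 | (K : Set G) * (N : Set G) = Set.univ}

/-- The family of the images in `G ⧸ N` of those `H` in `𝓗` with `HN ≠ G`. -/
def quotientFamily (𝓗 : Set (Subgroup G)) (N : Subgroup G) [N.Normal] :
    Set (Subgroup (G ⧸ N)) :=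
  (fun H => H.map (QuotientGroup.mk' N)) '' nonSupplements 𝓗 N

/-- The family of the subgroups `K ∩ N` of `N`, for those `K` in `𝓗` with `KN = G`. -/
def intersectionFamily (𝓗 : Set (Subgroup G)) (N : Subgroup G) : Set (Subgroup N) :=
  (fun K => K.subgroupOf N) '' supplements 𝓗 N

/-- The family `𝓗` is strongly divided by `N`. -/
structure StronglyDivided (𝓗 : Set (Subgroup G)) (N : Subgroup G) : Prop where
  le_of_mem : ∀ H ∈ nonSupplements 𝓗 N, N ≤ H
  sInf_mul : ∀ F : Finset (Subgroup G), (F : Set (Subgroup G)) ⊆ supplements 𝓗 N →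
    ((sInf (F : Set (Subgroup G)) : Subgroup G) : Set G) * (N : Set G) = Set.univ

end CosetComplex

/-! The complex $CC(G,\mathcal H)$ is isomorphic to the simplicial join of
$CC(G/N,\overline{\mathcal H})$ and $CC(N,\mathcal H\cap N)$. A coset of a non-supplement
$H\supseteq N$ is a union of cosets of $N$ and corresponds to its image in $G/N$. A coset of a
supplement $K$ meets $N$ and corresponds to its trace on $N$. Everything rests on
`StronglyDivided.exists_mem_sInter`: cosets of supplements with a common point have one in every
coset of $N$. Hence the conditions on the two kinds of cosets are independent, and a finite set of
cosets has a common point as soon as its two halves do. `injOn_cosetVertexMap`,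
`image_cosetVertexMap_mem_faces` and `exists_image_cosetVertexMap_eq` make this precise.

It remains to compare $|K*L|$ with $|K|*|L|$. There is a natural continuous bijection `toJoin`, but
its inverse need not be continuous, because the product topology on $|K|\times|L|\times[0,1]$ can be
coarser than the weak one. The remedy is `concentrate`, a self-map of a realisation that preserves
every closed simplex and locally takes values in a single one. Applied to both factors before the
inverse of `toJoin`, it gives the continuous map `ofJoin`. One composite is then a join of maps
homotopic to the identity. The other preserves closed simplices, so a straight-line homotopy joins
it to the identity. -/

namespace GeometricRealization

/-! ### Weak topology, closed simplices and straight-line homotopies -/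

section Basic

variable {V Z : Type*} {K : PreAbstractSimplicialComplex V}
  [TopologicalSpace Z]

theorem ext_coord {x y : GeometricRealization K} (h : ∀ v, x.coord v = y.coord v) : x = y :=
  Subtype.ext (Finsupp.ext h)

theorem coord_nonneg (x : GeometricRealization K) (v : V) : 0 ≤ x.coord v := x.2.1 v

theorem support_mem_faces (x : GeometricRealization K) : x.1.support ∈ K.faces := x.2.2.1

theorem degree_eq_one (x : GeometricRealization K) : x.1.degree = 1 := x.2.2.2

theorem coord_eq_zero_of_support_subset {x : GeometricRealization K} {s : Finset V}
    (h : x.1.support ⊆ s) {v : V} (hv : v ∉ s) : x.coord v = 0 :=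
  Finsupp.notMem_support_iff.1 fun h' => hv (h h')

theorem support_subset_of_coord_eq_zero {x : GeometricRealization K} {s : Finset V}
    (h : ∀ v, v ∉ s → x.coord v = 0) : x.1.support ⊆ s := fun v hv => by
  by_contra h'
  exact Finsupp.mem_support_iff.1 hv (h v h')

theorem degree_eq_sum_of_support_subset {x : V →₀ ℝ} {s : Finset V} (h : x.support ⊆ s) :
    x.degree = ∑ v ∈ s, x v :=
  Finset.sum_subset h fun _ _ hv => Finsupp.notMem_support_iff.1 hv

theorem sum_coord_eq_one {x : GeometricRealization K} {s : Finset V} (h : x.1.support ⊆ s) :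
    ∑ v ∈ s, x.coord v = 1 :=
  (degree_eq_sum_of_support_subset h).symm.trans x.degree_eq_one

/-- The point of the realisation with given barycentric coordinates, supported in a face. -/
def ofSupportSubset (x : V →₀ ℝ) (h0 : ∀ v, 0 ≤ x v) (h1 : x.degree = 1) {s : Finset V}
    (hs : s ∈ K.faces) (h : x.support ⊆ s) : GeometricRealization K :=
  ⟨x, h0, (K.isRelLowerSet_faces hs).2 h (by
    rw [Finsupp.support_nonempty_iff]
    rintro rfl
    simp at h1), h1⟩

/-- The closed simplex spanned by `s`, as a space with its Euclidean topology. -/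
def ClosedSimplex (K : PreAbstractSimplicialComplex V) (s : Finset V) : Type _ := closedSimplex K s

namespace ClosedSimplex

variable {s : Finset V}

instance : TopologicalSpace (ClosedSimplex K s) := simplexTopology K s

/-- The inclusion of a closed simplex into the realisation. -/
def incl (x : ClosedSimplex K s) : GeometricRealization K := Subtype.val x

theorem support_incl_subset (x : ClosedSimplex K s) : x.incl.1.support ⊆ s :=
  support_subset_of_coord_eq_zero x.2

/-- A point of the realisation supported in `s`, as a point of the closed simplex. -/
def ofPoint (x : GeometricRealization K) (h : x.1.support ⊆ s) : ClosedSimplex K s :=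
  ⟨x, fun _ hv => coord_eq_zero_of_support_subset h hv⟩

theorem isInducing_coord :
    Topology.IsInducing fun (x : ClosedSimplex K s) => x.incl.coord := ⟨rfl⟩

theorem continuous_coord_incl (v : V) :
    Continuous fun x : ClosedSimplex K s => x.incl.coord v :=
  (continuous_apply v).comp isInducing_coord.continuous

theorem continuous_of_coord {g : Z → ClosedSimplex K s}
    (h : ∀ v, Continuous fun z => (g z).incl.coord v) : Continuous g :=
  isInducing_coord.continuous_iff.2 (continuous_pi h)

theorem continuous_incl (hs : s ∈ K.faces) :
    Continuous (incl : ClosedSimplex K s → GeometricRealization K) :=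
  continuous_iff_coinduced_le.2 (le_iSup (fun s : K.faces => TopologicalSpace.coinduced
    (Subtype.val : closedSimplex K s.1 → GeometricRealization K) (simplexTopology K s.1)) ⟨s, hs⟩)

instance : IsEmpty (ClosedSimplex K (∅ : Finset V)) := ⟨fun x => by
  have h1 := sum_coord_eq_one x.support_incl_subset
  simp at h1⟩

/-- The empty set is allowed because a face of a simplicial join may have no vertices on one side.
-/
theorem continuous_incl' (hs : s = ∅ ∨ s ∈ K.faces) :
    Continuous (incl : ClosedSimplex K s → GeometricRealization K) := by
  rcases hs with rfl | hs
  · exact continuous_of_const fun x => isEmptyElim x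
  · exact continuous_incl hs

instance : T2Space (ClosedSimplex K s) :=
  T2Space.of_injective_continuous (f := fun x : ClosedSimplex K s => x.incl.coord)
    (fun _ _ h => Subtype.ext (ext_coord (congrFun h))) isInducing_coord.continuous

/-- In barycentric coordinates a closed simplex is a closed subset of a product of unit intervals.
Compactness is what later turns a continuous surjection from simplices into a quotient map. -/
theorem compactSpace (hs : s = ∅ ∨ s ∈ K.faces) : CompactSpace (ClosedSimplex K s) := by
  rcases hs with rfl | hs
  · infer_instance
  · rw [← isCompact_univ_iff, isInducing_coord.isCompact_iff]
    have : (fun x : ClosedSimplex K s => x.incl.coord) '' Set.univ =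
        (Set.univ.pi fun _ => Set.Icc (0 : ℝ) 1) ∩
          ({x | ∑ v ∈ s, x v = 1} ∩ ⋂ v ∈ (s : Set V)ᶜ, {x | x v = 0}) := by
      ext y
      simp only [Set.image_univ, Set.mem_range, Set.mem_inter_iff, Set.mem_pi, Set.mem_univ,
        true_implies, Set.mem_ofPred_eq, Set.mem_iInter, Set.mem_compl_iff, Finset.mem_coe]
      constructor
      · rintro ⟨x, rfl⟩
        have h1 := sum_coord_eq_one x.support_incl_subset
        refine ⟨fun v => ⟨coord_nonneg _ _, ?_⟩, h1, fun v hv =>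
          coord_eq_zero_of_support_subset x.support_incl_subset hv⟩
        by_cases hv : v ∈ s
        · exact h1 ▸ Finset.single_le_sum (f := x.incl.coord) (fun _ _ => coord_nonneg _ _) hv
        · rw [coord_eq_zero_of_support_subset x.support_incl_subset hv]
          exact zero_le_one
      · rintro ⟨h0, h1, h2⟩
        have hsub : (Finsupp.onFinset s y fun v hv => by
            by_contra h
            exact hv (h2 v h)).support ⊆ s := Finsupp.support_onFinset_subset
        exact ⟨ofPoint (ofSupportSubset _ (fun v => (h0 v).1)
          ((degree_eq_sum_of_support_subset hsub).trans h1) hs hsub) hsub, rfl⟩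
    rw [this]
    refine (isCompact_univ_pi fun _ => isCompact_Icc).inter_right (IsClosed.inter ?_ ?_)
    · exact isClosed_eq (by fun_prop) continuous_const
    · exact isClosed_biInter fun v _ => isClosed_eq (continuous_apply v) continuous_const

end ClosedSimplex

theorem continuous_iff_closedSimplex {f : GeometricRealization K → Z} :
    Continuous f ↔
      ∀ s ∈ K.faces, Continuous fun x : ClosedSimplex K s => f x.incl := by
  refine ⟨fun h s hs => h.comp (ClosedSimplex.continuous_incl hs), fun h => ?_⟩
  exact continuous_iSup_dom.2 fun s => continuous_coinduced_dom.2 (h s.1 s.2)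

theorem continuous_coord (v : V) : Continuous fun x : GeometricRealization K => x.coord v :=
  continuous_iff_closedSimplex.2 fun _ _ => ClosedSimplex.continuous_coord_incl v

theorem continuous_of_support_subset {f : Z → GeometricRealization K} {s : Finset V}
    (hs : s ∈ K.faces) (h : ∀ z, (f z).1.support ⊆ s)
    (hc : ∀ v, Continuous fun z => (f z).coord v) : Continuous f :=
  (ClosedSimplex.continuous_incl hs).comp
    (ClosedSimplex.continuous_of_coord (g := fun z => .ofPoint (f z) (h z)) hc)

/-- Coordinatewise continuity does not suffice for maps into the weak topology. It does when, near
each point, the values stay in one closed simplex, whose topology is the Euclidean one. -/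
theorem continuous_of_eventually_support_subset {f : Z → GeometricRealization K}
    (h : ∀ z₀, ∃ s ∈ K.faces, ∀ᶠ z in nhds z₀, (f z).1.support ⊆ s)
    (hc : ∀ v, Continuous fun z => (f z).coord v) : Continuous f := by
  refine continuous_iff_continuousAt.2 fun z₀ => ?_
  obtain ⟨s, hs, hU⟩ := h z₀
  refine ContinuousOn.continuousAt (s := {z | (f z).1.support ⊆ s}) ?_ hU
  rw [continuousOn_iff_continuous_domRestrict]
  exact continuous_of_support_subset hs (fun z => z.2) fun v => (hc v).comp continuous_subtype_val

theorem degree_smul (c : ℝ) (x : V →₀ ℝ) : (c • x).degree = c * x.degree := by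
  rw [degree_eq_sum_of_support_subset Finsupp.support_smul, Finsupp.degree_apply, Finset.mul_sum]
  rfl

theorem support_segment_subset {x y : V →₀ ℝ} (h : y.support ⊆ x.support) (t : ℝ) :
    ((1 - t) • y + t • x).support ⊆ x.support := by
  classical
  exact Finsupp.support_add.trans (Finset.union_subset (Finsupp.support_smul.trans h)
    Finsupp.support_smul)

/-- The point dividing the segment from `y` to `x`, where `y` lies in the closed carrier of `x`. -/
noncomputable def segment (x y : GeometricRealization K) (h : y.1.support ⊆ x.1.support) (t : I) :
    GeometricRealization K :=
  ofSupportSubset ((1 - (t : ℝ)) • y.1 + (t : ℝ) • x.1)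
    (fun v => add_nonneg (mul_nonneg (sub_nonneg.2 t.2.2) (y.coord_nonneg v))
      (mul_nonneg t.2.1 (x.coord_nonneg v)))
    (by rw [map_add, degree_smul, degree_smul, degree_eq_one, degree_eq_one]; ring)
    x.support_mem_faces (support_segment_subset h t)

theorem coord_segment (x y : GeometricRealization K) (h : y.1.support ⊆ x.1.support) (t : I)
    (v : V) : (segment x y h t).coord v = (1 - (t : ℝ)) * y.coord v + t * x.coord v := rfl

theorem support_segment (x y : GeometricRealization K) (h : y.1.support ⊆ x.1.support) (t : I) :
    (segment x y h t).1.support ⊆ x.1.support := support_segment_subset h t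

attribute [irreducible] segment

theorem continuous_segment_closedSimplex
    (f : C(GeometricRealization K, GeometricRealization K))
    (hf : ∀ x, (f x).1.support ⊆ x.1.support) {s : Finset V} (hs : s ∈ K.faces) :
    Continuous fun q : ClosedSimplex K s × I => segment q.1.incl (f q.1.incl) (hf _) q.2 := by
  refine continuous_of_support_subset hs
    (fun q => (support_segment _ _ (hf q.1.incl) q.2).trans q.1.support_incl_subset)
    fun v => ?_
  simp only [coord_segment]
  have h1 : Continuous fun x : ClosedSimplex K s => (f x.incl).coord v :=
    (continuous_coord v).comp (f.continuous.comp (ClosedSimplex.continuous_incl hs))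
  have h2 := ClosedSimplex.continuous_coord_incl (K := K) (s := s) v
  exact ((continuous_const.sub (continuous_subtype_val.comp continuous_snd)).mul
    (h1.comp continuous_fst)).add
      ((continuous_subtype_val.comp continuous_snd).mul (h2.comp continuous_fst))

theorem continuous_segment
    (f : C(GeometricRealization K, GeometricRealization K))
    (hf : ∀ x, (f x).1.support ⊆ x.1.support) :
    Continuous fun q : GeometricRealization K × I => segment q.1 (f q.1) (hf _) q.2 := by
  have hHt (x) : Continuous (segment x (f x) (hf x)) :=
    (continuous_segment_closedSimplex f hf x.support_mem_faces).comp
      (Continuous.prodMk_right (ClosedSimplex.ofPoint x subset_rfl))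
  -- The weak topology can be tested on closed simplices only for maps out of the realisation
  -- itself, not out of its product with `I`. Hence the homotopy is treated as a map into the path
  -- space, and uncurried at the end because `I` is locally compact.
  have hF : Continuous fun x => (⟨segment x (f x) (hf x), hHt x⟩ : C(I, GeometricRealization K)) :=
    continuous_iff_closedSimplex.2 fun s hs =>
      (ContinuousMap.mk _ (continuous_segment_closedSimplex f hf hs)).curry.continuous
  exact ContinuousMap.continuous_uncurry_of_continuous ⟨_, hF⟩

/-- A self-map of a realisation that preserves all closed simplices is homotopic to the identity,
by the straight-line homotopy. -/
theorem homotopic_id_of_support_subset (f : C(GeometricRealization K, GeometricRealization K))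
    (hf : ∀ x, (f x).1.support ⊆ x.1.support) :
    f.Homotopic (ContinuousMap.id _) :=
  ⟨{ toFun := fun q => segment q.2 (f q.2) (hf _) q.1
     continuous_toFun := (continuous_segment f hf).comp continuous_swap
     map_zero_left := fun x => ext_coord fun v => by
      rw [coord_segment]
      simp
     map_one_left := fun x => ext_coord fun v => by
      rw [coord_segment]
      simp }⟩

end Basic

/-! ### Simplicial maps and isomorphisms -/

section Functoriality

variable {V W : Type*} {K : PreAbstractSimplicialComplex V} {L : PreAbstractSimplicialComplex W}

theorem support_mapDomain_subset [DecidableEq W] {f : V → W} {s : Finset V} {t : Finset W}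
    (h : s.image f ⊆ t) {x : V →₀ ℝ} (hx : x.support ⊆ s) : (x.mapDomain f).support ⊆ t :=
  Finsupp.mapDomain_support.trans ((Finset.image_subset_image hx).trans h)

/-- The map of realisations induced by a simplicial map. -/
noncomputable def mapFun [DecidableEq W] (f : V → W) (h : ∀ s ∈ K.faces, s.image f ∈ L.faces)
    (x : GeometricRealization K) : GeometricRealization L :=
  ofSupportSubset (x.1.mapDomain f)
    (fun w => by
      rw [Finsupp.mapDomain, Finsupp.sum, Finsupp.finsetSum_apply]
      exact Finset.sum_nonneg fun v _ => Finsupp.single_nonneg.2 (x.coord_nonneg v) w)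
    ((Finsupp.degree_mapDomain f _).trans x.degree_eq_one)
    (h _ x.support_mem_faces) (support_mapDomain_subset subset_rfl subset_rfl)

theorem continuous_mapFun [DecidableEq W] (f : V → W) (h : ∀ s ∈ K.faces, s.image f ∈ L.faces) :
    Continuous (mapFun (K := K) (L := L) f h) := by
  refine continuous_iff_closedSimplex.2 fun s hs => continuous_of_support_subset (h s hs)
    (fun x => support_mapDomain_subset subset_rfl x.support_incl_subset) fun w => ?_
  have : ∀ x : ClosedSimplex K s, (mapFun (L := L) f h x.incl).coord w =
      ∑ v ∈ s, Finsupp.single (f v) (x.incl.coord v) w := fun x => by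
    change (x.incl.1.mapDomain f) w = _
    rw [Finsupp.mapDomain, Finsupp.sum_of_support_subset _ x.support_incl_subset _ (by simp),
      Finsupp.finsetSum_apply]
    rfl
  simp only [this, Finsupp.single_apply]
  refine continuous_finsetSum _ fun v _ => ?_
  split_ifs
  · exact ClosedSimplex.continuous_coord_incl v
  · exact continuous_const

/-- A vertex map which is injective on vertices and under which the faces of `L` are exactly the
images of the faces of `K` induces a homeomorphism of realisations. -/
theorem nonempty_homeomorph [DecidableEq W] (f : V → W)
    (hf : Set.InjOn f {v | ∃ s ∈ K.faces, v ∈ s})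
    (h : ∀ t, t ∈ L.faces ↔ ∃ s ∈ K.faces, s.image f = t) :
    Nonempty (GeometricRealization K ≃ₜ GeometricRealization L) := by
  classical
  -- The inverse vertex map `Function.invFunOn` needs a default vertex; without vertices both
  -- realisations are empty.
  rcases isEmpty_or_nonempty V with hV | hV
  · have hK : IsEmpty (GeometricRealization K) := ⟨fun x => by
      obtain ⟨v, -⟩ := (K.isRelLowerSet_faces x.support_mem_faces).1
      exact hV.false v⟩
    have hL : IsEmpty (GeometricRealization L) := ⟨fun x => by
      obtain ⟨s, hs, -⟩ := (h _).1 x.support_mem_faces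
      obtain ⟨v, -⟩ := (K.isRelLowerSet_faces hs).1
      exact hV.false v⟩
    exact ⟨Homeomorph.empty⟩
  have h1 : ∀ s ∈ K.faces, s.image f ∈ L.faces := fun s hs => (h _).2 ⟨s, hs, rfl⟩
  let g := Function.invFunOn f {v | ∃ s ∈ K.faces, v ∈ s}
  have hg : ∀ v, (∃ s ∈ K.faces, v ∈ s) → g (f v) = v := fun v hv => hf.leftInvOn_invFunOn hv
  have hgs : ∀ s ∈ K.faces, (s.image f).image g = s := fun s hs => by
    rw [Finset.image_image]
    exact (Finset.image_congr fun v hv => hg v ⟨s, hs, hv⟩).trans Finset.image_id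
  have h2 : ∀ t ∈ L.faces, t.image g ∈ K.faces := fun t ht => by
    obtain ⟨s, hs, rfl⟩ := (h t).1 ht
    rwa [hgs s hs]
  refine ⟨⟨⟨mapFun f h1, mapFun g h2, fun x => Subtype.ext ?_, fun y => Subtype.ext ?_⟩,
    continuous_mapFun f h1, continuous_mapFun g h2⟩⟩
  · change (x.1.mapDomain f).mapDomain g = x.1
    rw [← Finsupp.mapDomain_comp]
    refine (Finsupp.mapDomain_congr fun v hv => ?_).trans Finsupp.mapDomain_id
    exact hg v ⟨_, x.support_mem_faces, hv⟩
  · change (y.1.mapDomain g).mapDomain f = y.1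
    rw [← Finsupp.mapDomain_comp]
    refine (Finsupp.mapDomain_congr fun w hw => ?_).trans Finsupp.mapDomain_id
    obtain ⟨s, hs, hst⟩ := (h _).1 y.support_mem_faces
    rw [← hst, Finset.mem_image] at hw
    obtain ⟨v, hv, rfl⟩ := hw
    exact congrArg f (hg v ⟨s, hs, hv⟩)

end Functoriality

/-! ### A self-map with locally finite carrier, homotopic to the identity -/

section Concentration

variable {V : Type*} {K : PreAbstractSimplicialComplex V}

/-- Half the sum of the squares of the barycentric coordinates. -/
noncomputable def threshold (x : GeometricRealization K) : ℝ := x.1.sum fun _ r => r ^ 2 / 2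

theorem threshold_eq_sum {x : GeometricRealization K} {s : Finset V} (h : x.1.support ⊆ s) :
    x.threshold = ∑ v ∈ s, x.coord v ^ 2 / 2 :=
  Finsupp.sum_of_support_subset _ h _ (by simp)

theorem continuous_threshold : Continuous (threshold : GeometricRealization K → ℝ) := by
  refine continuous_iff_closedSimplex.2 fun s hs => ?_
  simp only [threshold_eq_sum (ClosedSimplex.support_incl_subset _)]
  exact continuous_finsetSum _ fun v _ =>
    ((ClosedSimplex.continuous_coord_incl v).pow 2).div_const 2

theorem threshold_pos (x : GeometricRealization K) : 0 < x.threshold := by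
  obtain ⟨v, hv⟩ := (K.isRelLowerSet_faces x.support_mem_faces).1
  rw [threshold_eq_sum subset_rfl]
  refine Finset.sum_pos (fun v hv => ?_) ⟨v, hv⟩
  have : x.coord v ≠ 0 := Finsupp.mem_support_iff.1 hv
  positivity

/-- The coordinates sum to 1, so if all were at most the threshold, then the sum of their squares
would be too. But the threshold is half that sum, and positive. -/
theorem exists_threshold_lt_coord (x : GeometricRealization K) :
    ∃ v ∈ x.1.support, x.threshold < x.coord v := by
  by_contra! h
  have h1 : ∑ v ∈ x.1.support, x.coord v ^ 2 ≤ ∑ v ∈ x.1.support, x.coord v * x.threshold :=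
    Finset.sum_le_sum fun v hv => by
      rw [sq]
      exact mul_le_mul_of_nonneg_left (h v hv) (x.coord_nonneg v)
  rw [← Finset.sum_mul, sum_coord_eq_one subset_rfl, one_mul] at h1
  have h2 := threshold_eq_sum (x := x) subset_rfl
  rw [← Finset.sum_div] at h2
  linarith [x.threshold_pos]

/-- The excess of the barycentric coordinates over the threshold. -/
noncomputable def excess (x : GeometricRealization K) : V →₀ ℝ :=
  Finsupp.onFinset x.1.support (fun v => max (x.coord v - x.threshold) 0) fun v hv =>
    Finsupp.mem_support_iff.2 fun h => hv (max_eq_right (by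
      change x.coord v = 0 at h
      linarith [x.threshold_pos]))

theorem excess_apply (x : GeometricRealization K) (v : V) :
    x.excess v = max (x.coord v - x.threshold) 0 := rfl

theorem support_excess_subset (x : GeometricRealization K) : x.excess.support ⊆ x.1.support :=
  Finsupp.support_onFinset_subset

theorem degree_excess_pos (x : GeometricRealization K) : 0 < x.excess.degree := by
  rw [degree_eq_sum_of_support_subset x.support_excess_subset]
  obtain ⟨v, hv, h⟩ := x.exists_threshold_lt_coord
  exact Finset.sum_pos' (fun _ _ => le_max_right _ _) ⟨v, hv, lt_max_of_lt_left (sub_pos.2 h)⟩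

theorem continuous_excess_apply (v : V) :
    Continuous fun x : GeometricRealization K => x.excess v :=
  ((continuous_coord v).sub continuous_threshold).max continuous_const

theorem continuous_degree_excess :
    Continuous fun x : GeometricRealization K => x.excess.degree := by
  refine continuous_iff_closedSimplex.2 fun s hs => ?_
  have (x : ClosedSimplex K s) : x.incl.excess.degree = ∑ v ∈ s, x.incl.excess v :=
    degree_eq_sum_of_support_subset (x.incl.support_excess_subset.trans x.support_incl_subset)
  simp only [this]
  exact continuous_finsetSum _ fun v _ =>
    (continuous_excess_apply v).comp (ClosedSimplex.continuous_incl hs)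

/-- The self-map of the realisation which rescales the excess of the barycentric coordinates over
the threshold. -/
noncomputable def concentrateFun (x : GeometricRealization K) : GeometricRealization K :=
  ofSupportSubset (x.excess.degree⁻¹ • x.excess)
    (fun _ => mul_nonneg (inv_nonneg.2 x.degree_excess_pos.le) (le_max_right _ _))
    (by rw [degree_smul, inv_mul_cancel₀ x.degree_excess_pos.ne'])
    x.support_mem_faces (Finsupp.support_smul.trans x.support_excess_subset)

theorem support_concentrateFun_subset_excess (x : GeometricRealization K) :
    x.concentrateFun.1.support ⊆ x.excess.support := Finsupp.support_smul

theorem support_concentrateFun_subset (x : GeometricRealization K) :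
    x.concentrateFun.1.support ⊆ x.1.support :=
  x.support_concentrateFun_subset_excess.trans x.support_excess_subset

/-- Locally, the map takes its values in a single closed simplex. -/
theorem eventually_support_concentrateFun_subset (x₀ : GeometricRealization K) :
    ∀ᶠ x : GeometricRealization K in nhds x₀, x.concentrateFun.1.support ⊆ x₀.1.support := by
  classical
  -- The mass outside the support of `x₀` is zero at `x₀`, hence below the threshold on a
  -- neighbourhood. There it bounds every coordinate outside that support, so the excess of each of
  -- these is zero.
  have h1 : Continuous fun x : GeometricRealization K =>
      1 - ∑ v ∈ x₀.1.support, x.coord v :=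
    continuous_const.sub (continuous_finsetSum _ fun v _ => continuous_coord v)
  have h2 : 1 - ∑ v ∈ x₀.1.support, x₀.coord v < x₀.threshold := by
    rw [sum_coord_eq_one subset_rfl, sub_self]
    exact x₀.threshold_pos
  filter_upwards [(isOpen_lt h1 continuous_threshold).mem_nhds h2] with x hx v hv
  by_contra hv₀
  have hv' := x.support_concentrateFun_subset_excess hv
  rw [Finsupp.mem_support_iff, excess_apply] at hv'
  apply hv'
  have h3 : ∑ w ∈ insert v x₀.1.support, x.coord w ≤ 1 := by
    refine le_trans ?_ (sum_coord_eq_one (x := x) (s := insert v x₀.1.support ∪ x.1.support)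
      Finset.subset_union_right).le
    exact Finset.sum_le_sum_of_subset_of_nonneg Finset.subset_union_left
      fun _ _ _ => x.coord_nonneg _
  rw [Finset.sum_insert hv₀] at h3
  have hx' : 1 - ∑ v ∈ x₀.1.support, x.coord v < x.threshold := hx
  exact max_eq_right (by linarith)

/-- The self-map `GeometricRealization.concentrateFun`, as a continuous map. -/
noncomputable def concentrate (K : PreAbstractSimplicialComplex V) :
    C(GeometricRealization K, GeometricRealization K) where
  toFun := concentrateFun
  continuous_toFun := continuous_of_eventually_support_subset
    (fun x₀ => ⟨_, x₀.support_mem_faces, x₀.eventually_support_concentrateFun_subset⟩)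
    fun v => (continuous_degree_excess.inv₀ fun x => x.degree_excess_pos.ne').mul
      (continuous_excess_apply v)

theorem concentrate_homotopic_id : (concentrate K).Homotopic (ContinuousMap.id _) :=
  homotopic_id_of_support_subset _ support_concentrateFun_subset

end Concentration

end GeometricRealization

/-! ### Functoriality and homotopy invariance of the topological join -/

namespace TopologicalJoin

variable {X Y X' Y' Z : Type*}

/-- The quotient map onto the join. -/
def mk (p : X ⊕ Y ⊕ X × Y × I) : TopologicalJoin X Y := Quot.mk _ p

theorem mk_zero (x : X) (y : Y) : mk (.inr (.inr (x, y, 0))) = mk (.inl x) :=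
  Quot.sound (.left x y)

theorem mk_one (x : X) (y : Y) : mk (.inr (.inr (x, y, 1))) = mk (.inr (.inl y)) :=
  Quot.sound (.right x y)

theorem mk_surjective : Function.Surjective (mk : _ → TopologicalJoin X Y) := Quot.exists_rep

/-- The function on the join given by compatible functions on the three pieces. -/
def lift (f : X → Z) (g : Y → Z) (h : X × Y × I → Z) (h0 : ∀ x y, h (x, y, 0) = f x)
    (h1 : ∀ x y, h (x, y, 1) = g y) : TopologicalJoin X Y → Z :=
  Quot.lift (Sum.elim f (Sum.elim g h)) fun _ _ r => by
    cases r with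
    | left x y => exact h0 x y
    | right x y => exact h1 x y

variable [TopologicalSpace X] [TopologicalSpace Y] [TopologicalSpace X'] [TopologicalSpace Y']
  [TopologicalSpace Z]

theorem continuous_mk : Continuous (mk : _ → TopologicalJoin X Y) := continuous_quot_mk

theorem continuous_lift {f : X → Z} {g : Y → Z} {h : X × Y × I → Z}
    {h0 : ∀ x y, h (x, y, 0) = f x} {h1 : ∀ x y, h (x, y, 1) = g y}
    (hf : Continuous f) (hg : Continuous g) (hh : Continuous h) :
    Continuous (lift f g h h0 h1) :=
  continuous_quot_lift _ (hf.sumElim (hg.sumElim hh))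

/-- The join of two continuous maps. -/
def map (f : C(X, X')) (g : C(Y, Y')) : C(TopologicalJoin X Y, TopologicalJoin X' Y') where
  toFun := lift (fun x => mk (.inl (f x))) (fun y => mk (.inr (.inl (g y))))
    (fun q => mk (.inr (.inr (f q.1, g q.2.1, q.2.2)))) (fun _ _ => mk_zero _ _)
    (fun _ _ => mk_one _ _)
  continuous_toFun := continuous_lift
    (continuous_mk.comp (continuous_inl.comp f.continuous))
    (continuous_mk.comp (continuous_inr.comp (continuous_inl.comp g.continuous)))
    (continuous_mk.comp (continuous_inr.comp (continuous_inr.comp (by fun_prop))))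

theorem map_id : map (ContinuousMap.id X) (ContinuousMap.id Y) = ContinuousMap.id _ := by
  ext p
  obtain ⟨x | y | q, rfl⟩ := mk_surjective p <;> rfl

/-- Joins of homotopic maps are homotopic. -/
theorem map_homotopic {f f' : C(X, X')} {g g' : C(Y, Y')} (hf : f.Homotopic f')
    (hg : g.Homotopic g') : (map f g).Homotopic (map f' g') := by
  obtain ⟨F⟩ := hf
  obtain ⟨G⟩ := hg
  let a : C(X × I, TopologicalJoin X' Y') :=
    ⟨fun q => mk (.inl (F (q.2, q.1))),
      continuous_mk.comp (continuous_inl.comp (by fun_prop))⟩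
  let b : C(Y × I, TopologicalJoin X' Y') :=
    ⟨fun q => mk (.inr (.inl (G (q.2, q.1)))),
      continuous_mk.comp (continuous_inr.comp (continuous_inl.comp (by fun_prop)))⟩
  let c : C((X × Y × I) × I, TopologicalJoin X' Y') :=
    ⟨fun q => mk (.inr (.inr (F (q.2, q.1.1), G (q.2, q.1.2.1), q.1.2.2))),
      continuous_mk.comp (continuous_inr.comp (continuous_inr.comp (by fun_prop)))⟩
  -- Mapping into the path space lets the homotopy descend by the universal property of the
  -- quotient, with no need to show that the quotient map times `I` is again a quotient map.
  let H : C(TopologicalJoin X Y, C(I, TopologicalJoin X' Y')) :=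
    ⟨lift a.curry b.curry c.curry (fun x y => ContinuousMap.ext fun t => mk_zero _ _)
      (fun x y => ContinuousMap.ext fun t => mk_one _ _),
      continuous_lift a.curry.continuous b.curry.continuous c.curry.continuous⟩
  refine ⟨⟨⟨fun q => H q.2 q.1,
    (ContinuousMap.continuous_uncurry_of_continuous H).comp continuous_swap⟩, ?_, ?_⟩⟩
  · intro p
    obtain ⟨x | y | q, rfl⟩ := mk_surjective p
    · exact congrArg (fun x => mk (.inl x)) (F.map_zero_left x)
    · exact congrArg (fun y => mk (.inr (.inl y))) (G.map_zero_left y)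
    · exact congrArg₂ (fun x y => mk (.inr (.inr (x, y, q.2.2)))) (F.map_zero_left q.1)
        (G.map_zero_left q.2.1)
  · intro p
    obtain ⟨x | y | q, rfl⟩ := mk_surjective p
    · exact congrArg (fun x => mk (.inl x)) (F.map_one_left x)
    · exact congrArg (fun y => mk (.inr (.inl y))) (G.map_one_left y)
    · exact congrArg₂ (fun x y => mk (.inr (.inr (x, y, q.2.2)))) (F.map_one_left q.1)
        (G.map_one_left q.2.1)

end TopologicalJoin

/-! ### Simplicial join versus topological join -/

/-- The simplicial join of two simplicial complexes. -/
def joinComplex {V W : Type*} (K : PreAbstractSimplicialComplex V)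
    (L : PreAbstractSimplicialComplex W) : PreAbstractSimplicialComplex (V ⊕ W) where
  faces := {s | s.Nonempty ∧ (s.toLeft = ∅ ∨ s.toLeft ∈ K.faces) ∧
    (s.toRight = ∅ ∨ s.toRight ∈ L.faces)}
  isRelLowerSet_faces := fun s hs => ⟨hs.1, fun t hts ht => ⟨ht, by
      have h : t.toLeft ⊆ s.toLeft := Finset.toLeft_subset_toLeft hts
      rcases t.toLeft.eq_empty_or_nonempty with h0 | h0
      · exact .inl h0
      · rcases hs.2.1 with h1 | h1
        · rw [h1] at h
          exact .inl (Finset.subset_empty.1 h)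
        · exact .inr ((K.isRelLowerSet_faces h1).2 h h0), by
      have h : t.toRight ⊆ s.toRight := Finset.toRight_subset_toRight hts
      rcases t.toRight.eq_empty_or_nonempty with h0 | h0
      · exact .inl h0
      · rcases hs.2.2 with h1 | h1
        · rw [h1] at h
          exact .inl (Finset.subset_empty.1 h)
        · exact .inr ((L.isRelLowerSet_faces h1).2 h h0)⟩⟩

namespace GeometricRealization

section Join

variable {V W : Type*} {K : PreAbstractSimplicialComplex V} {L : PreAbstractSimplicialComplex W}

theorem disjSum_mem_joinComplex {s : Finset V} {t : Finset W} (hs : s ∈ K.faces)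
    (ht : t ∈ L.faces) : s.disjSum t ∈ (joinComplex K L).faces := by
  refine ⟨?_, .inr (by rwa [Finset.toLeft_disjSum]), .inr (by rwa [Finset.toRight_disjSum])⟩
  obtain ⟨v, hv⟩ := (K.isRelLowerSet_faces hs).1
  exact ⟨.inl v, Finset.inl_mem_disjSum.2 hv⟩

theorem image_inl_mem_joinComplex [DecidableEq (V ⊕ W)] (s : Finset V) (hs : s ∈ K.faces) :
    s.image Sum.inl ∈ (joinComplex K L).faces := by
  have h1 : (s.image Sum.inl : Finset (V ⊕ W)).toLeft = s := by ext; simp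
  have h2 : (s.image Sum.inl : Finset (V ⊕ W)).toRight = ∅ := by ext; simp
  exact ⟨(K.isRelLowerSet_faces hs).1.image _, .inr (by rwa [h1]), .inl h2⟩

theorem image_inr_mem_joinComplex [DecidableEq (V ⊕ W)] (s : Finset W) (hs : s ∈ L.faces) :
    s.image Sum.inr ∈ (joinComplex K L).faces := by
  have h1 : (s.image Sum.inr : Finset (V ⊕ W)).toLeft = ∅ := by ext; simp
  have h2 : (s.image Sum.inr : Finset (V ⊕ W)).toRight = s := by ext; simp
  exact ⟨(L.isRelLowerSet_faces hs).1.image _, .inl h1, .inr (by rwa [h2])⟩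

open Classical in
/-- The inclusion of the left factor into the realisation of the simplicial join. -/
noncomputable def inlPoint (L : PreAbstractSimplicialComplex W) (x : GeometricRealization K) :
    GeometricRealization (joinComplex K L) :=
  mapFun Sum.inl (fun s hs => image_inl_mem_joinComplex s hs) x

open Classical in
/-- The inclusion of the right factor into the realisation of the simplicial join. -/
noncomputable def inrPoint (K : PreAbstractSimplicialComplex V) (y : GeometricRealization L) :
    GeometricRealization (joinComplex K L) :=
  mapFun Sum.inr (fun s hs => image_inr_mem_joinComplex s hs) y

theorem continuous_inlPoint : Continuous (inlPoint (K := K) L) := by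
  classical exact continuous_mapFun _ fun s hs => image_inl_mem_joinComplex s hs

theorem continuous_inrPoint : Continuous (inrPoint (L := L) K) := by
  classical exact continuous_mapFun _ fun s hs => image_inr_mem_joinComplex s hs

@[simp] theorem coord_inlPoint_inl (x : GeometricRealization K) (v : V) :
    (inlPoint L x).coord (.inl v) = x.coord v :=
  Finsupp.mapDomain_apply Sum.inl_injective _ _

@[simp] theorem coord_inlPoint_inr (x : GeometricRealization K) (w : W) :
    (inlPoint L x).coord (.inr w) = 0 :=
  Finsupp.mapDomain_of_notMem_range _ _ (by simp)

@[simp] theorem coord_inrPoint_inr (y : GeometricRealization L) (w : W) :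
    (inrPoint K y).coord (.inr w) = y.coord w :=
  Finsupp.mapDomain_apply Sum.inr_injective _ _

@[simp] theorem coord_inrPoint_inl (y : GeometricRealization L) (v : V) :
    (inrPoint K y).coord (.inl v) = 0 :=
  Finsupp.mapDomain_of_notMem_range _ _ (by simp)

theorem support_sumElim_subset {x : V →₀ ℝ} {y : W →₀ ℝ} {s : Finset V} {t : Finset W}
    (hx : x.support ⊆ s) (hy : y.support ⊆ t) :
    (Finsupp.sumElim x y).support ⊆ s.disjSum t := by
  rintro (v | w) h
  · exact Finset.inl_mem_disjSum.2 (hx (by simpa using h))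
  · exact Finset.inr_mem_disjSum.2 (hy (by simpa using h))

theorem degree_sumElim (x : V →₀ ℝ) (y : W →₀ ℝ) :
    (Finsupp.sumElim x y).degree = x.degree + y.degree := by
  rw [degree_eq_sum_of_support_subset (support_sumElim_subset subset_rfl subset_rfl),
    Finset.sum_disjSum]
  simp [Finsupp.degree_apply]

/-- The point `(1 - t) x + t y` of the realisation of the simplicial join. -/
noncomputable def joinPoint (x : GeometricRealization K) (y : GeometricRealization L) (t : I) :
    GeometricRealization (joinComplex K L) :=
  ofSupportSubset (Finsupp.sumElim ((1 - (t : ℝ)) • x.1) ((t : ℝ) • y.1))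
    (by
      rintro (v | w)
      · exact mul_nonneg (sub_nonneg.2 t.2.2) (x.coord_nonneg v)
      · exact mul_nonneg t.2.1 (y.coord_nonneg w))
    (by rw [degree_sumElim, degree_smul, degree_smul, degree_eq_one, degree_eq_one]; ring)
    (disjSum_mem_joinComplex x.support_mem_faces y.support_mem_faces)
    (support_sumElim_subset Finsupp.support_smul Finsupp.support_smul)

@[simp] theorem coord_joinPoint_inl (x : GeometricRealization K) (y : GeometricRealization L)
    (t : I) (v : V) : (joinPoint x y t).coord (.inl v) = (1 - t) * x.coord v := rfl

@[simp] theorem coord_joinPoint_inr (x : GeometricRealization K) (y : GeometricRealization L)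
    (t : I) (w : W) : (joinPoint x y t).coord (.inr w) = t * y.coord w := rfl

theorem joinPoint_zero (x : GeometricRealization K) (y : GeometricRealization L) :
    joinPoint x y 0 = inlPoint L x :=
  ext_coord (by rintro (v | w) <;> simp)

theorem joinPoint_one (x : GeometricRealization K) (y : GeometricRealization L) :
    joinPoint x y 1 = inrPoint K y :=
  ext_coord (by rintro (v | w) <;> simp)

attribute [irreducible] inlPoint inrPoint joinPoint

/-- The barycentric coordinates of the left vertices. -/
noncomputable def leftPart (z : GeometricRealization (joinComplex K L)) : V →₀ ℝ :=
  z.1.comapDomain Sum.inl Sum.inl_injective.injOn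

/-- The barycentric coordinates of the right vertices. -/
noncomputable def rightPart (z : GeometricRealization (joinComplex K L)) : W →₀ ℝ :=
  z.1.comapDomain Sum.inr Sum.inr_injective.injOn

theorem leftPart_apply (z : GeometricRealization (joinComplex K L)) (v : V) :
    z.leftPart v = z.coord (.inl v) := rfl

theorem rightPart_apply (z : GeometricRealization (joinComplex K L)) (w : W) :
    z.rightPart w = z.coord (.inr w) := rfl

theorem support_leftPart_subset (z : GeometricRealization (joinComplex K L)) :
    z.leftPart.support ⊆ z.1.support.toLeft := fun v hv => by
  have h : z.leftPart v ≠ 0 := Finsupp.mem_support_iff.1 hv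
  rwa [Finset.mem_toLeft, Finsupp.mem_support_iff]

theorem support_rightPart_subset (z : GeometricRealization (joinComplex K L)) :
    z.rightPart.support ⊆ z.1.support.toRight := fun w hw => by
  have h : z.rightPart w ≠ 0 := Finsupp.mem_support_iff.1 hw
  rwa [Finset.mem_toRight, Finsupp.mem_support_iff]

theorem degree_leftPart_add_degree_rightPart (z : GeometricRealization (joinComplex K L)) :
    z.leftPart.degree + z.rightPart.degree = 1 := by
  rw [← degree_sumElim, ← z.degree_eq_one]
  congr 1
  ext (v | w) <;> rfl

theorem degree_leftPart_nonneg (z : GeometricRealization (joinComplex K L)) :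
    0 ≤ z.leftPart.degree := Finset.sum_nonneg fun _ _ => z.coord_nonneg _

theorem degree_rightPart_nonneg (z : GeometricRealization (joinComplex K L)) :
    0 ≤ z.rightPart.degree := Finset.sum_nonneg fun _ _ => z.coord_nonneg _

theorem coord_inl_eq_zero {z : GeometricRealization (joinComplex K L)}
    (h : z.leftPart.degree = 0) (v : V) : z.coord (.inl v) = 0 := by
  by_contra hv
  exact hv ((Finset.sum_eq_zero_iff_of_nonneg fun _ _ => z.coord_nonneg _).1 h v
    (Finsupp.mem_support_iff.2 hv))

theorem coord_inr_eq_zero {z : GeometricRealization (joinComplex K L)}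
    (h : z.rightPart.degree = 0) (w : W) : z.coord (.inr w) = 0 := by
  by_contra hw
  exact hw ((Finset.sum_eq_zero_iff_of_nonneg fun _ _ => z.coord_nonneg _).1 h w
    (Finsupp.mem_support_iff.2 hw))

/-- The normalised left part of a point of the join. -/
noncomputable def leftPoint (z : GeometricRealization (joinComplex K L))
    (h : z.leftPart.degree ≠ 0) : GeometricRealization K :=
  ofSupportSubset (s := z.1.support.toLeft) (z.leftPart.degree⁻¹ • z.leftPart)
    (fun _ => mul_nonneg (inv_nonneg.2 z.degree_leftPart_nonneg) (z.coord_nonneg _))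
    (by rw [degree_smul, inv_mul_cancel₀ h])
    (z.support_mem_faces.2.1.resolve_left fun h0 => h (Finset.sum_eq_zero fun v hv =>
      absurd (h0 ▸ z.support_leftPart_subset hv) (Finset.notMem_empty v)))
    (Finsupp.support_smul.trans z.support_leftPart_subset)

/-- The normalised right part of a point of the join. -/
noncomputable def rightPoint (z : GeometricRealization (joinComplex K L))
    (h : z.rightPart.degree ≠ 0) : GeometricRealization L :=
  ofSupportSubset (s := z.1.support.toRight) (z.rightPart.degree⁻¹ • z.rightPart)
    (fun _ => mul_nonneg (inv_nonneg.2 z.degree_rightPart_nonneg) (z.coord_nonneg _))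
    (by rw [degree_smul, inv_mul_cancel₀ h])
    (z.support_mem_faces.2.2.resolve_left fun h0 => h (Finset.sum_eq_zero fun v hv =>
      absurd (h0 ▸ z.support_rightPart_subset hv) (Finset.notMem_empty v)))
    (Finsupp.support_smul.trans z.support_rightPart_subset)

theorem coord_leftPoint (z : GeometricRealization (joinComplex K L))
    (h : z.leftPart.degree ≠ 0) (v : V) :
    (z.leftPoint h).coord v = z.leftPart.degree⁻¹ * z.coord (.inl v) := rfl

theorem coord_rightPoint (z : GeometricRealization (joinComplex K L))
    (h : z.rightPart.degree ≠ 0) (w : W) :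
    (z.rightPoint h).coord w = z.rightPart.degree⁻¹ * z.coord (.inr w) := rfl

theorem support_leftPoint_subset {z : GeometricRealization (joinComplex K L)}
    (h : z.leftPart.degree ≠ 0) {s : Finset (V ⊕ W)} (hs : z.1.support ⊆ s) :
    (z.leftPoint h).1.support ⊆ s.toLeft :=
  support_subset_of_coord_eq_zero fun v hv => by
    rw [coord_leftPoint, coord_eq_zero_of_support_subset hs (fun h' => hv (Finset.mem_toLeft.2 h')),
      mul_zero]

theorem support_rightPoint_subset {z : GeometricRealization (joinComplex K L)}
    (h : z.rightPart.degree ≠ 0) {s : Finset (V ⊕ W)} (hs : z.1.support ⊆ s) :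
    (z.rightPoint h).1.support ⊆ s.toRight :=
  support_subset_of_coord_eq_zero fun v hv => by
    rw [coord_rightPoint,
      coord_eq_zero_of_support_subset hs (fun h' => hv (Finset.mem_toRight.2 h')), mul_zero]

attribute [irreducible] leftPoint rightPoint

theorem inrPoint_rightPoint {z : GeometricRealization (joinComplex K L)}
    (h : z.leftPart.degree = 0) (h' : z.rightPart.degree ≠ 0) :
    inrPoint K (z.rightPoint h') = z := by
  have h1 := z.degree_leftPart_add_degree_rightPart
  rw [h, zero_add] at h1
  refine ext_coord ?_
  rintro (v | w)
  · rw [coord_inrPoint_inl, coord_inl_eq_zero h]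
  · rw [coord_inrPoint_inr, coord_rightPoint, h1, inv_one, one_mul]

theorem inlPoint_leftPoint {z : GeometricRealization (joinComplex K L)}
    (h : z.rightPart.degree = 0) (h' : z.leftPart.degree ≠ 0) :
    inlPoint L (z.leftPoint h') = z := by
  have h1 := z.degree_leftPart_add_degree_rightPart
  rw [h, add_zero] at h1
  refine ext_coord ?_
  rintro (v | w)
  · rw [coord_inlPoint_inl, coord_leftPoint, h1, inv_one, one_mul]
  · rw [coord_inlPoint_inr, coord_inr_eq_zero h]

/-- The total mass of the right vertices. -/
noncomputable def joinParameter (z : GeometricRealization (joinComplex K L)) : I :=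
  ⟨z.rightPart.degree, z.degree_rightPart_nonneg, by
    linarith [z.degree_leftPart_nonneg, z.degree_leftPart_add_degree_rightPart]⟩

theorem coe_joinParameter (z : GeometricRealization (joinComplex K L)) :
    (z.joinParameter : ℝ) = z.rightPart.degree := rfl

theorem joinPoint_leftPoint_rightPoint {z : GeometricRealization (joinComplex K L)}
    (h : z.leftPart.degree ≠ 0) (h' : z.rightPart.degree ≠ 0) :
    joinPoint (z.leftPoint h) (z.rightPoint h') z.joinParameter = z := by
  have h1 := z.degree_leftPart_add_degree_rightPart
  refine ext_coord ?_
  rintro (v | w)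
  · rw [coord_joinPoint_inl, coord_leftPoint, coe_joinParameter, ← h1, add_sub_cancel_right,
      mul_inv_cancel_left₀ h]
  · rw [coord_joinPoint_inr, coord_rightPoint, coe_joinParameter, mul_inv_cancel_left₀ h']

theorem rightPart_degree_ne_zero {z : GeometricRealization (joinComplex K L)}
    (h : z.leftPart.degree = 0) : z.rightPart.degree ≠ 0 := by
  have h1 := z.degree_leftPart_add_degree_rightPart
  rw [h, zero_add] at h1
  rw [h1]
  exact one_ne_zero

open Classical in
/-- The bijection from the realisation of the simplicial join to the join of the realisations. -/
noncomputable def toJoinFun (z : GeometricRealization (joinComplex K L)) :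
    TopologicalJoin (GeometricRealization K) (GeometricRealization L) :=
  if h : z.leftPart.degree = 0 then .mk (.inr (.inl (z.rightPoint (rightPart_degree_ne_zero h))))
  else if h' : z.rightPart.degree = 0 then .mk (.inl (z.leftPoint h))
  else .mk (.inr (.inr (z.leftPoint h, z.rightPoint h', z.joinParameter)))

theorem leftPart_inlPoint (x : GeometricRealization K) : (inlPoint L x).leftPart = x.1 :=
  Finsupp.ext fun v => by rw [leftPart_apply, coord_inlPoint_inl]; rfl

theorem rightPart_inlPoint (x : GeometricRealization K) : (inlPoint L x).rightPart = 0 :=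
  Finsupp.ext fun w => by rw [rightPart_apply, coord_inlPoint_inr]; rfl

theorem leftPart_inrPoint (y : GeometricRealization L) : (inrPoint K y).leftPart = 0 :=
  Finsupp.ext fun v => by rw [leftPart_apply, coord_inrPoint_inl]; rfl

theorem rightPart_inrPoint (y : GeometricRealization L) : (inrPoint K y).rightPart = y.1 :=
  Finsupp.ext fun w => by rw [rightPart_apply, coord_inrPoint_inr]; rfl

theorem leftPart_joinPoint (x : GeometricRealization K) (y : GeometricRealization L) (t : I) :
    (joinPoint x y t).leftPart = (1 - (t : ℝ)) • x.1 :=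
  Finsupp.ext fun v => by rw [leftPart_apply, coord_joinPoint_inl]; rfl

theorem rightPart_joinPoint (x : GeometricRealization K) (y : GeometricRealization L) (t : I) :
    (joinPoint x y t).rightPart = (t : ℝ) • y.1 :=
  Finsupp.ext fun v => by rw [rightPart_apply, coord_joinPoint_inr]; rfl

theorem toJoinFun_inlPoint (x : GeometricRealization K) :
    toJoinFun (inlPoint L x) = .mk (.inl x) := by
  have h1 : (inlPoint L x).leftPart.degree = 1 := by rw [leftPart_inlPoint, degree_eq_one]
  have h : (inlPoint L x).leftPart.degree ≠ 0 := h1 ▸ one_ne_zero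
  have h' : (inlPoint L x).rightPart.degree = 0 := by rw [rightPart_inlPoint, map_zero]
  rw [toJoinFun, dif_neg h, dif_pos h']
  congr 2
  exact ext_coord fun v => by rw [coord_leftPoint, h1, inv_one, one_mul, coord_inlPoint_inl]

theorem toJoinFun_inrPoint (y : GeometricRealization L) :
    toJoinFun (inrPoint K y) = .mk (.inr (.inl y)) := by
  have h1 : (inrPoint K y).rightPart.degree = 1 := by rw [rightPart_inrPoint, degree_eq_one]
  have h' : (inrPoint K y).leftPart.degree = 0 := by rw [leftPart_inrPoint, map_zero]
  rw [toJoinFun, dif_pos h']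
  congr 3
  exact ext_coord fun v => by rw [coord_rightPoint, h1, inv_one, one_mul, coord_inrPoint_inr]

theorem toJoinFun_joinPoint (x : GeometricRealization K) (y : GeometricRealization L) (t : I) :
    toJoinFun (joinPoint x y t) = .mk (.inr (.inr (x, y, t))) := by
  -- At the two ends one of the parts has mass zero and cannot be normalised; there the
  -- identifications of the join take over.
  by_cases ht0 : t = 0
  · rw [ht0, joinPoint_zero, toJoinFun_inlPoint, TopologicalJoin.mk_zero]
  by_cases ht1 : t = 1
  · rw [ht1, joinPoint_one, toJoinFun_inrPoint, TopologicalJoin.mk_one]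
  have ht0' : (t : ℝ) ≠ 0 := fun h => ht0 (Subtype.ext h)
  have ht1' : 1 - (t : ℝ) ≠ 0 := fun h => ht1 (Subtype.ext (sub_eq_zero.1 h).symm)
  have h1 : (joinPoint x y t).leftPart.degree = 1 - t := by
    rw [leftPart_joinPoint, degree_smul, degree_eq_one, mul_one]
  have h2 : (joinPoint x y t).rightPart.degree = t := by
    rw [rightPart_joinPoint, degree_smul, degree_eq_one, mul_one]
  have h : (joinPoint x y t).leftPart.degree ≠ 0 := h1 ▸ ht1'
  have h' : (joinPoint x y t).rightPart.degree ≠ 0 := h2 ▸ ht0'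
  rw [toJoinFun, dif_neg h, dif_neg h']
  have e1 : (joinPoint x y t).leftPoint h = x := ext_coord fun v => by
    rw [coord_leftPoint, h1, coord_joinPoint_inl, inv_mul_cancel_left₀ ht1']
  have e2 : (joinPoint x y t).rightPoint h' = y := ext_coord fun v => by
    rw [coord_rightPoint, h2, coord_joinPoint_inr, inv_mul_cancel_left₀ ht0']
  have e3 : (joinPoint x y t).joinParameter = t := Subtype.ext h2
  rw [e1, e2, e3]

theorem support_inlPoint_subset {s : Finset (V ⊕ W)} {x : GeometricRealization K}
    (hx : x.1.support ⊆ s.toLeft) : (inlPoint L x).1.support ⊆ s := by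
  refine support_subset_of_coord_eq_zero ?_
  rintro (v | w) h
  · rw [coord_inlPoint_inl]
    exact coord_eq_zero_of_support_subset hx fun h' => h (Finset.mem_toLeft.1 h')
  · exact coord_inlPoint_inr x w

theorem support_inrPoint_subset {s : Finset (V ⊕ W)} {y : GeometricRealization L}
    (hy : y.1.support ⊆ s.toRight) : (inrPoint K y).1.support ⊆ s := by
  refine support_subset_of_coord_eq_zero ?_
  rintro (v | w) h
  · exact coord_inrPoint_inl y v
  · rw [coord_inrPoint_inr]
    exact coord_eq_zero_of_support_subset hy fun h' => h (Finset.mem_toRight.1 h')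

theorem support_joinPoint_subset {s : Finset (V ⊕ W)} {x : GeometricRealization K}
    {y : GeometricRealization L} (hx : x.1.support ⊆ s.toLeft) (hy : y.1.support ⊆ s.toRight)
    (t : I) : (joinPoint x y t).1.support ⊆ s := by
  refine support_subset_of_coord_eq_zero ?_
  rintro (v | w) h
  · rw [coord_joinPoint_inl,
      coord_eq_zero_of_support_subset hx fun h' => h (Finset.mem_toLeft.1 h'), mul_zero]
  · rw [coord_joinPoint_inr,
      coord_eq_zero_of_support_subset hy fun h' => h (Finset.mem_toRight.1 h'), mul_zero]

/-- A closed simplex of the join is a quotient of the pieces of the join of two closed simplices. -/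
noncomputable def joinSimplexMap (K : PreAbstractSimplicialComplex V)
    (L : PreAbstractSimplicialComplex W) (s : Finset (V ⊕ W)) :
    ClosedSimplex K s.toLeft ⊕ ClosedSimplex L s.toRight ⊕
      ClosedSimplex K s.toLeft × ClosedSimplex L s.toRight × I →
    ClosedSimplex (joinComplex K L) s :=
  Sum.elim (fun x => .ofPoint (inlPoint L x.incl) (support_inlPoint_subset x.support_incl_subset))
    (Sum.elim
      (fun y => .ofPoint (inrPoint K y.incl) (support_inrPoint_subset y.support_incl_subset))
      fun q => .ofPoint (joinPoint q.1.incl q.2.1.incl q.2.2)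
        (support_joinPoint_subset q.1.support_incl_subset q.2.1.support_incl_subset _))

theorem ClosedSimplex.incl_ofPoint {s : Finset V} (x : GeometricRealization K)
    (h : x.1.support ⊆ s) : (ClosedSimplex.ofPoint x h).incl = x := rfl

theorem continuous_joinSimplexMap (s : Finset (V ⊕ W)) : Continuous (joinSimplexMap K L s) := by
  refine Continuous.sumElim ?_ (Continuous.sumElim ?_ ?_) <;>
    refine ClosedSimplex.continuous_of_coord ?_ <;> rintro (v | w) <;>
    simp only [ClosedSimplex.incl_ofPoint, coord_inlPoint_inl, coord_inlPoint_inr,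
      coord_inrPoint_inl, coord_inrPoint_inr, coord_joinPoint_inl, coord_joinPoint_inr]
  · exact ClosedSimplex.continuous_coord_incl v
  · exact continuous_const
  · exact continuous_const
  · exact ClosedSimplex.continuous_coord_incl w
  · exact (continuous_const.sub
      (continuous_subtype_val.comp (continuous_snd.comp continuous_snd))).mul
      ((ClosedSimplex.continuous_coord_incl v).comp continuous_fst)
  · exact (continuous_subtype_val.comp (continuous_snd.comp continuous_snd)).mul
      ((ClosedSimplex.continuous_coord_incl w).comp (continuous_fst.comp continuous_snd))

theorem surjective_joinSimplexMap (s : Finset (V ⊕ W)) :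
    Function.Surjective (joinSimplexMap K L s) := by
  intro z
  by_cases h : z.incl.leftPart.degree = 0
  · exact ⟨.inr (.inl (.ofPoint (z.incl.rightPoint (rightPart_degree_ne_zero h))
      (support_rightPoint_subset _ z.support_incl_subset))),
      Subtype.ext (inrPoint_rightPoint h _)⟩
  by_cases h' : z.incl.rightPart.degree = 0
  · exact ⟨.inl (.ofPoint (z.incl.leftPoint h)
      (support_leftPoint_subset _ z.support_incl_subset)),
      Subtype.ext (inlPoint_leftPoint h' _)⟩
  · exact ⟨.inr (.inr (.ofPoint (z.incl.leftPoint h)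
      (support_leftPoint_subset _ z.support_incl_subset), .ofPoint (z.incl.rightPoint h')
      (support_rightPoint_subset _ z.support_incl_subset), z.incl.joinParameter)),
      Subtype.ext (joinPoint_leftPoint_rightPoint h h')⟩

/-- On a face, `joinSimplexMap` is a continuous surjection from a compact space to a Hausdorff one,
hence a quotient map. After composing with it, the map becomes the inclusions of closed simplices
followed by the projection onto the join. -/
theorem continuous_toJoinFun :
    Continuous (toJoinFun : GeometricRealization (joinComplex K L) → _) := by
  refine continuous_iff_closedSimplex.2 fun s hs => ?_
  have := ClosedSimplex.compactSpace hs.2.1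
  have := ClosedSimplex.compactSpace hs.2.2
  have hq : Topology.IsQuotientMap (joinSimplexMap K L s) :=
    (continuous_joinSimplexMap s).isClosedMap.isQuotientMap (continuous_joinSimplexMap s)
      (surjective_joinSimplexMap s)
  have hi := ClosedSimplex.continuous_incl' hs.2.1
  have hj := ClosedSimplex.continuous_incl' hs.2.2
  refine hq.continuous_iff.2 ?_
  have heq : (fun x : ClosedSimplex (joinComplex K L) s => toJoinFun x.incl) ∘
      joinSimplexMap K L s = TopologicalJoin.mk ∘ Sum.map ClosedSimplex.incl
        (Sum.map ClosedSimplex.incl (Prod.map ClosedSimplex.incl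
          (Prod.map ClosedSimplex.incl id))) := by
    funext p
    rcases p with x | y | q
    · exact toJoinFun_inlPoint _
    · exact toJoinFun_inrPoint _
    · exact toJoinFun_joinPoint _ _ _
  rw [heq]
  exact TopologicalJoin.continuous_mk.comp
    (hi.sumMap (hj.sumMap (hi.prodMap (hj.prodMap continuous_id))))

/-- The continuous bijection from the realisation of the simplicial join to the join of the
realisations. -/
noncomputable def toJoin (K : PreAbstractSimplicialComplex V) (L : PreAbstractSimplicialComplex W) :
    C(GeometricRealization (joinComplex K L),
      TopologicalJoin (GeometricRealization K) (GeometricRealization L)) :=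
  ⟨toJoinFun, continuous_toJoinFun⟩

/-- The map from the join of the realisations to the realisation of the simplicial join which
concentrates both factors. -/
noncomputable def ofJoin (K : PreAbstractSimplicialComplex V) (L : PreAbstractSimplicialComplex W) :
    C(TopologicalJoin (GeometricRealization K) (GeometricRealization L),
      GeometricRealization (joinComplex K L)) where
  toFun := TopologicalJoin.lift (fun x => inlPoint L (concentrate K x))
    (fun y => inrPoint K (concentrate L y))
    (fun q => joinPoint (concentrate K q.1) (concentrate L q.2.1) q.2.2)
    (fun _ _ => joinPoint_zero _ _) (fun _ _ => joinPoint_one _ _)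
  continuous_toFun := by
    refine TopologicalJoin.continuous_lift (continuous_inlPoint.comp (concentrate K).continuous)
      (continuous_inrPoint.comp (concentrate L).continuous)
      (continuous_of_eventually_support_subset (fun q₀ => ⟨_, disjSum_mem_joinComplex
        q₀.1.support_mem_faces q₀.2.1.support_mem_faces, ?_⟩) ?_)
    -- This is where concentration is needed: near `q₀` both concentrated factors stay in the
    -- carriers of the factors of `q₀`, so the values lie in the simplex joining these carriers.
    · have h1 := continuous_fst.continuousAt.eventually
        (eventually_support_concentrateFun_subset q₀.1)
      have h2 := (continuous_fst.comp continuous_snd).continuousAt.eventually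
        (eventually_support_concentrateFun_subset q₀.2.1)
      filter_upwards [h1, h2] with q hq1 hq2
      refine support_joinPoint_subset ?_ ?_ _
      · rw [Finset.toLeft_disjSum]
        exact hq1
      · rw [Finset.toRight_disjSum]
        exact hq2
    · rintro (v | w)
      · simp only [coord_joinPoint_inl]
        exact (continuous_const.sub
          (continuous_subtype_val.comp (continuous_snd.comp continuous_snd))).mul
          (((continuous_coord v).comp (concentrate K).continuous).comp continuous_fst)
      · simp only [coord_joinPoint_inr]
        exact (continuous_subtype_val.comp (continuous_snd.comp continuous_snd)).mul
          (((continuous_coord w).comp (concentrate L).continuous).comp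
            (continuous_fst.comp continuous_snd))

theorem toJoin_comp_ofJoin :
    (toJoin K L).comp (ofJoin K L) = TopologicalJoin.map (concentrate K) (concentrate L) := by
  ext p
  obtain ⟨x | y | q, rfl⟩ := TopologicalJoin.mk_surjective p
  · exact toJoinFun_inlPoint _
  · exact toJoinFun_inrPoint _
  · exact toJoinFun_joinPoint _ _ _

/-- Concentration never enlarges a support, and this is all the straight-line homotopy to the
identity requires. -/
theorem support_ofJoin_toJoin_subset (z : GeometricRealization (joinComplex K L)) :
    (ofJoin K L (toJoin K L z)).1.support ⊆ z.1.support := by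
  have hl (h : z.leftPart.degree ≠ 0) :
      (concentrate K (z.leftPoint h)).1.support ⊆ z.1.support.toLeft :=
    (support_concentrateFun_subset _).trans (support_leftPoint_subset h subset_rfl)
  have hr (h : z.rightPart.degree ≠ 0) :
      (concentrate L (z.rightPoint h)).1.support ⊆ z.1.support.toRight :=
    (support_concentrateFun_subset _).trans (support_rightPoint_subset h subset_rfl)
  change (ofJoin K L (toJoinFun z)).1.support ⊆ _
  rw [toJoinFun]
  split_ifs with h h'
  · exact support_inrPoint_subset (hr _)
  · exact support_inlPoint_subset (hl _)
  · exact support_joinPoint_subset (hl _) (hr _) _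

/-- The realisation of the simplicial join is homotopy equivalent to the topological join of the
realisations. -/
noncomputable def joinHomotopyEquiv (K : PreAbstractSimplicialComplex V)
    (L : PreAbstractSimplicialComplex W) :
    GeometricRealization (joinComplex K L) ≃ₕ
      TopologicalJoin (GeometricRealization K) (GeometricRealization L) where
  toFun := toJoin K L
  invFun := ofJoin K L
  left_inv := homotopic_id_of_support_subset _ support_ofJoin_toJoin_subset
  right_inv := by
    rw [toJoin_comp_ofJoin, ← TopologicalJoin.map_id]
    exact TopologicalJoin.map_homotopic concentrate_homotopic_id concentrate_homotopic_id

end Join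

end GeometricRealization

/-! ### The coset complex as a simplicial join -/

section CosetJoin

variable {G : Type*} [Group G] {N : Subgroup G} {𝓗 : Set (Subgroup G)}

theorem cosetCollection_cases {C : Set G} (hC : C ∈ cosetCollection 𝓗) (N : Subgroup G) :
    C ∈ cosetCollection (nonSupplements 𝓗 N) ∨ C ∈ cosetCollection (supplements 𝓗 N) := by
  obtain ⟨H, hH, g, rfl⟩ := hC
  by_cases h : (H : Set G) * (N : Set G) = Set.univ
  · exact .inr ⟨H, ⟨hH, h⟩, g, rfl⟩
  · exact .inl ⟨H, ⟨hH, h⟩, g, rfl⟩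

theorem smul_eq_smul_of_mem {H : Subgroup G} {x g : G} (h : x ∈ g • (H : Set G)) :
    g • (H : Set G) = x • (H : Set G) :=
  (leftCoset_eq_iff H).2 (Set.mem_smul_set_iff_inv_smul_mem.1 h)

namespace StronglyDivided

theorem mul_eq_self (hdiv : StronglyDivided 𝓗 N) {C : Set G}
    (hC : C ∈ cosetCollection (nonSupplements 𝓗 N)) : C * (N : Set G) = C := by
  obtain ⟨H, hH, g, rfl⟩ := hC
  rw [smul_mul_assoc]
  congr 1
  refine subset_antisymm ?_ (Set.subset_mul_left _ N.one_mem)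
  rintro _ ⟨h, hh, n, hn, rfl⟩
  exact H.mul_mem hh (hdiv.le_of_mem H hH hn)

/-- Finitely many cosets of supplements with a common point have a common point in each coset
of `N`. -/
theorem exists_mem_sInter (hdiv : StronglyDivided 𝓗 N) (S : Finset (Set G))
    (hS : ∀ C ∈ S, C ∈ cosetCollection (supplements 𝓗 N)) {x : G} (hx : ∀ C ∈ S, x ∈ C) (y : G) :
    ∃ z, (∀ C ∈ S, z ∈ C) ∧ y⁻¹ * z ∈ N := by
  classical
  -- With the common point `x` as representative of every coset, the intersection of the cosets is
  -- the translate by `x` of an intersection of supplements, to which the second divisibility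
  -- condition applies.
  have h : ∀ C : S, ∃ K ∈ supplements 𝓗 N, C.1 = x • (K : Set G) := fun C => by
    obtain ⟨K, hK, g, hg⟩ := hS C C.2
    exact ⟨K, hK, hg.trans (smul_eq_smul_of_mem (hg ▸ hx C C.2))⟩
  choose k hk hk' using h
  have hF : ((Finset.univ.image k : Finset (Subgroup G)) : Set (Subgroup G)) ⊆
      supplements 𝓗 N := by
    intro K hK
    obtain ⟨C, -, rfl⟩ := Finset.mem_image.1 hK
    exact hk C
  -- Writing $x^{-1}y=ln$ with $l$ in all the supplements and $n\in N$, the point $xl=yn^{-1}$ lies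
  -- in all the cosets and in $yN$.
  obtain ⟨l, hl, n, hn, hln⟩ : x⁻¹ * y ∈ ((sInf ((Finset.univ.image k : Finset (Subgroup G)) :
      Set (Subgroup G)) : Subgroup G) : Set G) * (N : Set G) := by
    rw [hdiv.sInf_mul _ hF]
    trivial
  refine ⟨x * l, fun C hC => ?_, ?_⟩
  · rw [show C = x • (k ⟨C, hC⟩ : Set G) from hk' ⟨C, hC⟩]
    refine Set.smul_mem_smul_set (Subgroup.mem_sInf.1 hl _ ?_)
    exact Finset.mem_image_of_mem k (Finset.mem_univ _)
  · have : y⁻¹ * (x * l) = n⁻¹ := by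
      have hln' : l * n = x⁻¹ * y := hln
      have hy : y = x * (l * n) := by rw [hln', mul_inv_cancel_left]
      rw [hy]
      group
    rw [this]
    exact N.inv_mem hn

/-- Since $(K_1\cap K_2)N=G$, an element of $K_1$ is $ln$ with $l\in K_1\cap K_2$ and $n\in N$. Then
$n\in K_1\cap N\subseteq K_2$. Thus a supplement in the family is determined by its trace on $N$. -/
theorem le_of_subgroupOf_eq (hdiv : StronglyDivided 𝓗 N) {K₁ K₂ : Subgroup G}
    (h₁ : K₁ ∈ supplements 𝓗 N) (h₂ : K₂ ∈ supplements 𝓗 N)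
    (h : ∀ n ∈ N, n ∈ K₁ → n ∈ K₂) : K₁ ≤ K₂ := by
  classical
  intro k hk
  have hF : (({K₁, K₂} : Finset (Subgroup G)) : Set (Subgroup G)) ⊆ supplements 𝓗 N := by
    intro K hK
    rcases Finset.mem_insert.1 hK with rfl | hK
    · exact h₁
    · exact Finset.mem_singleton.1 hK ▸ h₂
  obtain ⟨l, hl, n, hn, rfl⟩ : k ∈ ((sInf (({K₁, K₂} : Finset (Subgroup G)) :
      Set (Subgroup G)) : Subgroup G) : Set G) * (N : Set G) := by
    rw [hdiv.sInf_mul _ hF]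
    trivial
  have hl₁ : l ∈ K₁ := Subgroup.mem_sInf.1 hl _ (by simp)
  have hl₂ : l ∈ K₂ := Subgroup.mem_sInf.1 hl _ (by simp)
  exact K₂.mul_mem hl₂ (h n hn ((K₁.mul_mem_cancel_left hl₁).1 hk))

end StronglyDivided

/-- Multiplying by $N$ gives all of $G$, which a coset of a proper subgroup is not. So invariance
under $N$ tells the two kinds of cosets apart. -/
theorem mul_ne_self_of_mem_supplements (hproper : ∀ H ∈ 𝓗, H ≠ ⊤) {C : Set G}
    (hC : C ∈ cosetCollection (supplements 𝓗 N)) : C * (N : Set G) ≠ C := by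
  obtain ⟨K, hK, g, rfl⟩ := hC
  rw [smul_mul_assoc, hK.2]
  intro h
  refine hproper K hK.1 (SetLike.coe_injective ?_)
  rw [← smul_left_cancel_iff g, ← h, Subgroup.coe_top]

theorem exists_eq_smul_of_mem_supplements {C : Set G}
    (hC : C ∈ cosetCollection (supplements 𝓗 N)) :
    ∃ K ∈ supplements 𝓗 N, ∃ n : N, C = (n : G) • (K : Set G) := by
  obtain ⟨K, hK, g, rfl⟩ := hC
  -- From $g^{-1}=kn$ one gets $gk=n^{-1}$, a point of $gK\cap N$ that can serve as representative.
  obtain ⟨k, hk, n, hn, hkn⟩ : g⁻¹ ∈ (K : Set G) * (N : Set G) := by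
    rw [hK.2]
    trivial
  have hkn' : k * n = g⁻¹ := hkn
  refine ⟨K, hK, ⟨n⁻¹, N.inv_mem hn⟩, smul_eq_smul_of_mem ?_⟩
  rw [Set.mem_smul_set_iff_inv_smul_mem, ← hkn', smul_eq_mul, mul_inv_cancel_right]
  exact hk

theorem preimage_val_smul (K : Subgroup G) (n : N) :
    (Subtype.val ⁻¹' ((n : G) • (K : Set G)) : Set N) = n • (K.subgroupOf N : Set N) := by
  ext m
  rw [Set.mem_preimage, Set.mem_smul_set_iff_inv_smul_mem, Set.mem_smul_set_iff_inv_smul_mem]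
  rfl

theorem preimage_mem_cosetCollection {C : Set G} (hC : C ∈ cosetCollection (supplements 𝓗 N)) :
    (Subtype.val ⁻¹' C : Set N) ∈ cosetCollection (intersectionFamily 𝓗 N) := by
  obtain ⟨K, hK, n, rfl⟩ := exists_eq_smul_of_mem_supplements hC
  exact ⟨_, ⟨K, hK, rfl⟩, n, preimage_val_smul K n⟩

variable [N.Normal]

theorem image_mk_smul (H : Subgroup G) (g : G) :
    (QuotientGroup.mk' N) '' (g • (H : Set G)) =
      (QuotientGroup.mk' N g) • (H.map (QuotientGroup.mk' N) : Set (G ⧸ N)) := by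
  rw [Set.image_smul_distrib, Subgroup.coe_map]

theorem mem_of_mk_mem_image {C : Set G} (hC : C * (N : Set G) = C) {x : G}
    (h : QuotientGroup.mk' N x ∈ QuotientGroup.mk' N '' C) : x ∈ C := by
  obtain ⟨c, hc, hcx⟩ := h
  rw [← hC]
  exact ⟨c, hc, c⁻¹ * x, QuotientGroup.eq.1 hcx, mul_inv_cancel_left c x⟩

open Classical in
/-- The bijection between the vertices of the coset complex and those of the join. -/
noncomputable def cosetVertexMap (N : Subgroup G) [N.Normal] (C : Set G) : Set (G ⧸ N) ⊕ Set N :=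
  if C * (N : Set G) = C then .inl (QuotientGroup.mk' N '' C) else .inr (Subtype.val ⁻¹' C)

theorem cosetVertexMap_of_mul_eq {C : Set G} (h : C * (N : Set G) = C) :
    cosetVertexMap N C = .inl (QuotientGroup.mk' N '' C) := if_pos h

theorem cosetVertexMap_of_mul_ne {C : Set G} (h : C * (N : Set G) ≠ C) :
    cosetVertexMap N C = .inr (Subtype.val ⁻¹' C) := if_neg h

theorem image_mem_cosetCollection {C : Set G} (hC : C ∈ cosetCollection (nonSupplements 𝓗 N)) :
    QuotientGroup.mk' N '' C ∈ cosetCollection (quotientFamily 𝓗 N) := by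
  obtain ⟨H, hH, g, rfl⟩ := hC
  exact ⟨_, ⟨H, hH, rfl⟩, _, image_mk_smul H g⟩

/-- An $N$-invariant set is recovered from its image in $G/N$. For two cosets of supplements with
the same trace on $N$, a point of the trace represents both, and then the subgroups agree by
`StronglyDivided.le_of_subgroupOf_eq`. -/
theorem injOn_cosetVertexMap (hproper : ∀ H ∈ 𝓗, H ≠ ⊤) (hdiv : StronglyDivided 𝓗 N) :
    Set.InjOn (cosetVertexMap N) (cosetCollection 𝓗) := by
  intro C hC D hD h
  rcases cosetCollection_cases hC N with hC | hC <;> rcases cosetCollection_cases hD N with hD | hD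
  · have hC' := hdiv.mul_eq_self hC
    have hD' := hdiv.mul_eq_self hD
    rw [cosetVertexMap_of_mul_eq hC', cosetVertexMap_of_mul_eq hD', Sum.inl.injEq] at h
    exact subset_antisymm
      (fun x hx => mem_of_mk_mem_image hD' (h ▸ Set.mem_image_of_mem _ hx))
      (fun x hx => mem_of_mk_mem_image hC' (h ▸ Set.mem_image_of_mem _ hx))
  · rw [cosetVertexMap_of_mul_eq (hdiv.mul_eq_self hC),
      cosetVertexMap_of_mul_ne (mul_ne_self_of_mem_supplements hproper hD)] at h
    exact absurd h Sum.inl_ne_inr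
  · rw [cosetVertexMap_of_mul_eq (hdiv.mul_eq_self hD),
      cosetVertexMap_of_mul_ne (mul_ne_self_of_mem_supplements hproper hC)] at h
    exact absurd h Sum.inr_ne_inl
  · rw [cosetVertexMap_of_mul_ne (mul_ne_self_of_mem_supplements hproper hC),
      cosetVertexMap_of_mul_ne (mul_ne_self_of_mem_supplements hproper hD), Sum.inr.injEq] at h
    obtain ⟨K₁, h₁, n, rfl⟩ := exists_eq_smul_of_mem_supplements hC
    obtain ⟨K₂, h₂, m, rfl⟩ := exists_eq_smul_of_mem_supplements hD
    have hn : n ∈ (Subtype.val ⁻¹' ((m : G) • (K₂ : Set G)) : Set N) := by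
      rw [← h, Set.mem_preimage]
      exact mem_own_leftCoset K₁.toSubmonoid (n : G)
    have hnm : (m : G) • (K₂ : Set G) = (n : G) • (K₂ : Set G) := smul_eq_smul_of_mem hn
    rw [hnm, preimage_val_smul, preimage_val_smul, smul_left_cancel_iff] at h
    have hK : ∀ l (hl : l ∈ N), l ∈ K₁ ↔ l ∈ K₂ := fun l hl => Set.ext_iff.1 h ⟨l, hl⟩
    rw [hnm, le_antisymm (hdiv.le_of_subgroupOf_eq h₁ h₂ fun l hl => (hK l hl).1)
      (hdiv.le_of_subgroupOf_eq h₂ h₁ fun l hl => (hK l hl).2)]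

theorem image_cosetVertexMap_mem_faces [DecidableEq (Set (G ⧸ N) ⊕ Set N)]
    (hproper : ∀ H ∈ 𝓗, H ≠ ⊤) (hdiv : StronglyDivided 𝓗 N)
    {s : Finset (Set G)} (hs : s ∈ (cosetComplex 𝓗).faces) :
    s.image (cosetVertexMap N) ∈ (joinComplex (cosetComplex (quotientFamily 𝓗 N))
      (cosetComplex (intersectionFamily 𝓗 N))).faces := by
  classical
  obtain ⟨hne, hsub, x, hx⟩ := hs
  have hl : ∀ D, D ∈ (s.image (cosetVertexMap N)).toLeft →
      ∃ C ∈ s, C ∈ cosetCollection (nonSupplements 𝓗 N) ∧ QuotientGroup.mk' N '' C = D := by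
    intro D hD
    obtain ⟨C, hC, hCD⟩ := Finset.mem_image.1 (Finset.mem_toLeft.1 hD)
    rcases cosetCollection_cases (hsub hC) N with h | h
    · rw [cosetVertexMap_of_mul_eq (hdiv.mul_eq_self h), Sum.inl.injEq] at hCD
      exact ⟨C, hC, h, hCD⟩
    · rw [cosetVertexMap_of_mul_ne (mul_ne_self_of_mem_supplements hproper h)] at hCD
      exact absurd hCD Sum.inr_ne_inl
  have hr : ∀ D, D ∈ (s.image (cosetVertexMap N)).toRight →
      ∃ C ∈ s, C ∈ cosetCollection (supplements 𝓗 N) ∧ Subtype.val ⁻¹' C = D := by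
    intro D hD
    obtain ⟨C, hC, hCD⟩ := Finset.mem_image.1 (Finset.mem_toRight.1 hD)
    rcases cosetCollection_cases (hsub hC) N with h | h
    · rw [cosetVertexMap_of_mul_eq (hdiv.mul_eq_self h)] at hCD
      exact absurd hCD Sum.inl_ne_inr
    · rw [cosetVertexMap_of_mul_ne (mul_ne_self_of_mem_supplements hproper h),
        Sum.inr.injEq] at hCD
      exact ⟨C, hC, h, hCD⟩
  refine ⟨hne.image _, ?_, ?_⟩
  · refine (Finset.eq_empty_or_nonempty _).imp_right fun h => ⟨h, fun D hD => ?_,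
      QuotientGroup.mk' N x, fun D hD => ?_⟩
    · obtain ⟨C, -, hC, rfl⟩ := hl D hD
      exact image_mem_cosetCollection hC
    · obtain ⟨C, hC, -, rfl⟩ := hl D hD
      exact Set.mem_image_of_mem _ (hx C hC)
  -- The common point `x` need not lie in `N`; it is replaced by a common point of the supplement
  -- cosets in the coset $1\cdot N$.
  · obtain ⟨z, hz, hzN⟩ := hdiv.exists_mem_sInter
      (s.filter fun C => C ∈ cosetCollection (supplements 𝓗 N))
      (fun C hC => (Finset.mem_filter.1 hC).2) (fun C hC => hx C (Finset.mem_filter.1 hC).1) 1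
    rw [inv_one, one_mul] at hzN
    refine (Finset.eq_empty_or_nonempty _).imp_right fun h => ⟨h, fun D hD => ?_,
      ⟨z, hzN⟩, fun D hD => ?_⟩
    · obtain ⟨C, -, hC, rfl⟩ := hr D hD
      exact preimage_mem_cosetCollection hC
    · obtain ⟨C, hC, hC', rfl⟩ := hr D hD
      exact hz C (Finset.mem_filter.2 ⟨hC, hC'⟩)

theorem exists_image_cosetVertexMap_eq [DecidableEq (Set (G ⧸ N) ⊕ Set N)]
    (hproper : ∀ H ∈ 𝓗, H ≠ ⊤) (hdiv : StronglyDivided 𝓗 N) {t : Finset (Set (G ⧸ N) ⊕ Set N)}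
    (ht : t ∈ (joinComplex (cosetComplex (quotientFamily 𝓗 N))
      (cosetComplex (intersectionFamily 𝓗 N))).faces) :
    ∃ s ∈ (cosetComplex 𝓗).faces, s.image (cosetVertexMap N) = t := by
  classical
  obtain ⟨hne, hl, hr⟩ := ht
  have hsub : (t : Set _) ⊆ cosetVertexMap N '' cosetCollection 𝓗 := by
    rintro (D | D) hD
    · have hD' : D ∈ t.toLeft := Finset.mem_toLeft.2 hD
      have h := hl.resolve_left (Finset.ne_empty_of_mem hD')
      obtain ⟨_, ⟨H, hH, rfl⟩, q, rfl⟩ := h.2.1 hD'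
      obtain ⟨g, rfl⟩ := QuotientGroup.mk'_surjective N q
      refine ⟨g • (H : Set G), ⟨H, hH.1, g, rfl⟩, ?_⟩
      rw [cosetVertexMap_of_mul_eq (hdiv.mul_eq_self ⟨H, hH, g, rfl⟩), image_mk_smul]
    · have hD' : D ∈ t.toRight := Finset.mem_toRight.2 hD
      have h := hr.resolve_left (Finset.ne_empty_of_mem hD')
      obtain ⟨_, ⟨K, hK, rfl⟩, n, rfl⟩ := h.2.1 hD'
      refine ⟨(n : G) • (K : Set G), ⟨K, hK.1, n, rfl⟩, ?_⟩
      rw [cosetVertexMap_of_mul_ne (mul_ne_self_of_mem_supplements hproper ⟨K, hK, n, rfl⟩),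
        preimage_val_smul]
  obtain ⟨s, hs, rfl⟩ := Finset.subset_set_image_iff.1 hsub
  have hy : ∃ y : G, ∀ C ∈ s, C ∈ cosetCollection (nonSupplements 𝓗 N) →
      QuotientGroup.mk' N y ∈ QuotientGroup.mk' N '' C := by
    have hmem : ∀ C ∈ s, C ∈ cosetCollection (nonSupplements 𝓗 N) →
        QuotientGroup.mk' N '' C ∈ (s.image (cosetVertexMap N)).toLeft := fun C hC hC' => by
      rw [Finset.mem_toLeft, ← cosetVertexMap_of_mul_eq (hdiv.mul_eq_self hC')]
      exact Finset.mem_image_of_mem _ hC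
    rcases hl with hl | ⟨-, -, q, hq⟩
    -- With no vertices on this side there is no condition, and any element would do.
    · exact ⟨1, fun C hC hC' => absurd (hl ▸ hmem C hC hC') (Finset.notMem_empty _)⟩
    · obtain ⟨y, rfl⟩ := QuotientGroup.mk'_surjective N q
      exact ⟨y, fun C hC hC' => hq _ (hmem C hC hC')⟩
  have hx : ∃ x : G, ∀ C ∈ s, C ∈ cosetCollection (supplements 𝓗 N) → x ∈ C := by
    have hmem : ∀ C ∈ s, C ∈ cosetCollection (supplements 𝓗 N) →
        Subtype.val ⁻¹' C ∈ (s.image (cosetVertexMap N)).toRight := fun C hC hC' => by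
      rw [Finset.mem_toRight,
        ← cosetVertexMap_of_mul_ne (mul_ne_self_of_mem_supplements hproper hC')]
      exact Finset.mem_image_of_mem _ hC
    rcases hr with hr | ⟨-, -, n, hn⟩
    · exact ⟨1, fun C hC hC' => absurd (hr ▸ hmem C hC hC') (Finset.notMem_empty _)⟩
    · exact ⟨n, fun C hC hC' => hn _ (hmem C hC hC')⟩
  obtain ⟨y, hy⟩ := hy
  obtain ⟨x, hx⟩ := hx
  -- Here `x` is common to the supplement cosets, and `y` is common to the others. Moving `x` within
  -- the supplement cosets to a point `z` of $yN$ serves both, since the other cosets are invariant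
  -- under `N`.
  obtain ⟨z, hz, hzN⟩ := hdiv.exists_mem_sInter
    (s.filter fun C => C ∈ cosetCollection (supplements 𝓗 N))
    (fun C hC => (Finset.mem_filter.1 hC).2)
    (fun C hC => hx C (Finset.mem_filter.1 hC).1 (Finset.mem_filter.1 hC).2) y
  refine ⟨s, ⟨Finset.image_nonempty.1 hne, hs, z, fun C hC => ?_⟩, rfl⟩
  rcases cosetCollection_cases (hs hC) N with h | h
  · refine mem_of_mk_mem_image (hdiv.mul_eq_self h) ?_
    have hyz : QuotientGroup.mk' N z = QuotientGroup.mk' N y := (QuotientGroup.eq.2 hzN).symm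
    rw [hyz]
    exact hy C hC h
  · exact hz C (Finset.mem_filter.2 ⟨hC, h⟩)

end CosetJoin

theorem theoremC {G : Type*} [Group G] (N : Subgroup G) [N.Normal] (𝓗 : Set (Subgroup G))
    (hproper : ∀ H ∈ 𝓗, H ≠ ⊤) (hdiv : StronglyDivided 𝓗 N) :
    Nonempty (GeometricRealization (cosetComplex 𝓗) ≃ₕ
      TopologicalJoin (GeometricRealization (cosetComplex (quotientFamily 𝓗 N)))
        (GeometricRealization (cosetComplex (intersectionFamily 𝓗 N)))) := by
  classical
  have hinj : Set.InjOn (cosetVertexMap N) {C | ∃ s ∈ (cosetComplex 𝓗).faces, C ∈ s} :=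
    (injOn_cosetVertexMap hproper hdiv).mono fun C ⟨_, hs, hC⟩ => hs.2.1 hC
  obtain ⟨e⟩ := GeometricRealization.nonempty_homeomorph (L := joinComplex
    (cosetComplex (quotientFamily 𝓗 N)) (cosetComplex (intersectionFamily 𝓗 N)))
    (cosetVertexMap N) hinj fun t =>
      ⟨exists_image_cosetVertexMap_eq hproper hdiv, by
        rintro ⟨s, hs, rfl⟩
        exact image_cosetVertexMap_mem_faces hproper hdiv hs⟩
  exact ⟨e.toHomotopyEquiv.trans (GeometricRealization.joinHomotopyEquiv _ _)⟩
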